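/- Let $n\ge 3$ and let $q=1+2^{n-1}c$ with $c$ odd be a prime power. Let $\delta_1$ be an integer with $0\le\delta_1\le 2^{n-2}-2$ and $2^{n-2}-2\delta_1\ge 0$. Then for all nonnegative integers $c_l,c_r$ with $c_l+c_r<2^n$ there exists a $(c_l,c_r)$-$[[2^n+c_l+c_r,\;2^{n-2}-2\delta_1]]_q$ quantum synchronizable code that corrects at least up to $\lfloor (2^{n-2}-1)/2\rfloor$ bit errors and at least up to $2^{n-3}$ phase errors. Here qudits have $q$ levels labelled by $\mathbb F_q$. For $e,p\in\mathbb F_q^N$ let $X(e)|v\rangle=|v+e\rangle$ (bit errors on $\mathrm{wt}(e)$ qudits) and $Z(p)|v\rangle=\chi(p\cdot v)|v\rangle$ (phase errors on $\mathrm{wt}(p)$ qudits), where $\chi(x)=e^{2\pi i\,\mathrm{Tr}(x)/\ell}$, $\ell$ is the characteristic of $\mathbb F_q$ and $\mathrm{Tr}$ is the trace to $\mathbb F_\ell$. A $(c_l,c_r)$-$[[N,k]]_q$ quantum synchronizable code correcting up to $t_b$ bit errors and $t_p$ phase errors is an isometric encoding $V$ of $k$ logical qudits into a block of $N$ qudits,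 sent inside a stream of qudits, for which the following holds. The receiver's nominal frame of length $N$ starts $a$ positions to the right of the true start of the block, for an unknown integer $a$ with $-c_l\le a\le c_r$. The receiver can access the frame together with the $c_r$ qudits preceding and the $c_l$ qudits following it. There is one quantum channel on these $N+c_l+c_r$ qudits which, for all such $a$, all $e,p\in\mathbb F_q^N$ with $\mathrm{wt}(e)\le t_b$ and $\mathrm{wt}(p)\le t_p$ applied as $X(e)Z(p)$ to the block, and every joint state of the logical qudits and the $c_l+c_r$ accessible qudits outside the block, outputs exactly that joint state together with the value of $a$. -/

import Mathlib

open scoped Matrix Kronecker ComplexOrder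

noncomputable section

namespace QSync

/-!  A register of `N` qudits with levels labelled by the finite field `F` has the computational
basis `Fin N → F`. Operators between registers are complex matrices in these bases. -/

/-- The additive character `x ↦ exp (2 π i Tr(x) / p)` of a finite field of characteristic `p`,
where `Tr` is the trace to the prime field. -/
def phaseChar (F : Type*) [Field F] [Finite F] : AddChar F ℂ :=
  haveI : CharP F (ringChar F) := ringChar.charP F
  haveI : NeZero (ringChar F) := ⟨CharP.ringChar_ne_zero_of_finite F⟩
  letI : Algebra (ZMod (ringChar F)) F := ZMod.algebra F (ringChar F)
  (ZMod.stdAddChar (N := ringChar F)).compAddMonoidHom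
    (Algebra.trace (ZMod (ringChar F)) F).toAddMonoidHom

/-- The bit error (shift) operator `|v⟩ ↦ |v + e⟩`. It acts on the qudits in the support
of `e`. -/
def bitError {F : Type*} [Field F] [DecidableEq F] {N : ℕ} (e : Fin N → F) :
    Matrix (Fin N → F) (Fin N → F) ℂ :=
  Matrix.of fun w v => if w = v + e then 1 else 0

/-- The phase error (clock) operator `|v⟩ ↦ χ(p · v) |v⟩`. It acts on the qudits in the support
of `p`. -/
def phaseError {F : Type*} [Field F] [Finite F] [DecidableEq F] {N : ℕ} (p : Fin N → F) :
    Matrix (Fin N → F) (Fin N → F) ℂ :=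
  Matrix.diagonal fun v => phaseChar F (p ⬝ᵥ v)

/-- Density matrices. -/
def IsState {α : Type*} [Fintype α] (ρ : Matrix α α ℂ) : Prop :=
  ρ.PosSemidef ∧ ρ.trace = 1

/-- Quantum channels, that is, completely positive trace-preserving maps, in Kraus form. -/
def IsChannel {α β : Type*} [Fintype α] [Fintype β] [DecidableEq α]
    (Φ : Matrix α α ℂ → Matrix β β ℂ) : Prop :=
  ∃ (r : ℕ) (K : Fin r → Matrix β α ℂ),
    ∑ i, (K i)ᴴ * K i = 1 ∧ ∀ ρ, Φ ρ = ∑ i, K i * ρ * (K i)ᴴ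

/-- The possible misalignments: up to `cl` qudits to the left (negative values) and up to `cr`
qudits to the right (positive values). -/
abbrev Misalignment (cl cr : ℕ) : Type :=
  {a : ℤ // a ∈ Finset.Icc (-(cl : ℤ)) (cr : ℤ)}

/-- The receiver believes that the block of `N` qudits starts at a nominal position, which is `a`
qudits to the right of the true one. He can access the `N` qudits of his nominal frame together
with the `cr` qudits preceding it and the `cl` qudits following it in the stream; this is the place
in that window where the transmitted block really starts. -/
def offset {cl cr : ℕ} (a : Misalignment cl cr) : ℕ := ((cr : ℤ) - a.1).toNat

theorem offset_le {cl cr : ℕ} (a : Misalignment cl cr) : offset a ≤ cl + cr := by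
  have h := Finset.mem_Icc.mp a.2
  unfold offset
  omega

/-- The symbols in the receiver's window: the symbols `y` of the stream that do not belong to the
block, in their order, with the block `x` inserted at the true starting position. -/
def window {F : Type*} {cl cr N : ℕ} (a : Misalignment cl cr) (x : Fin N → F)
    (y : Fin (cl + cr) → F) : Fin (N + (cl + cr)) → F := fun j =>
  if h₁ : j.1 < offset a then y ⟨j.1, lt_of_lt_of_le h₁ (offset_le a)⟩
  else if h₂ : j.1 < offset a + N then x ⟨j.1 - offset a, by omega⟩
  else y ⟨j.1 - N, by omega⟩

/-- The isometry `|x⟩ ⊗ |y⟩ ↦ |window a x y⟩` that arranges the qudits of the block and the other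
accessible qudits of the stream in the order in which the receiver sees them. -/
def windowMatrix (F : Type*) [DecidableEq F] {cl cr : ℕ} (N : ℕ) (a : Misalignment cl cr) :
    Matrix (Fin (N + (cl + cr)) → F) ((Fin N → F) × (Fin (cl + cr) → F)) ℂ :=
  Matrix.of fun z xy => if z = window a xy.1 xy.2 then 1 else 0

/-- The operator from the logical register and the other accessible qudits of the stream to the
receiver's window: encode with `V`, apply the phase error `p` and the bit error `e` to the
transmitted block, and read the stream with misalignment `a`. -/
def received {F : Type*} [Field F] [Fintype F] [DecidableEq F] {cl cr N k : ℕ}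
    (V : Matrix (Fin N → F) (Fin k → F) ℂ) (a : Misalignment cl cr) (e p : Fin N → F) :
    Matrix (Fin (N + (cl + cr)) → F) ((Fin k → F) × (Fin (cl + cr) → F)) ℂ :=
  windowMatrix F N a *
    ((bitError e * phaseError p * V) ⊗ₖ
      (1 : Matrix (Fin (cl + cr) → F) (Fin (cl + cr) → F) ℂ))

/-- `V` is the encoder of a `(cl, cr)-[[N, k]]` quantum synchronizable code over `F` that corrects
up to `tb` bit errors and up to `tp` phase errors: `V` encodes `k` logical qudits isometrically
into `N` physical qudits, and one quantum channel `R`, applied to the receiver's window, restores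
the logical state and determines the misalignment `a`, for every misalignment by at most `cl` qudits
to the left and at most `cr` to the right, all bit errors on at most `tb` and phase errors on at
most `tp` qudits of the block, and every joint state `τ` of the logical register and the other
qudits of the window, which are left undisturbed. -/
def IsQSC {F : Type*} [Field F] [Fintype F] [DecidableEq F] (cl cr : ℕ) {N k : ℕ} (tb tp : ℕ)
    (V : Matrix (Fin N → F) (Fin k → F) ℂ) : Prop :=
  Vᴴ * V = 1 ∧
  ∃ R : Matrix (Fin (N + (cl + cr)) → F) (Fin (N + (cl + cr)) → F) ℂ →
      Matrix (((Fin k → F) × (Fin (cl + cr) → F)) × Misalignment cl cr)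
        (((Fin k → F) × (Fin (cl + cr) → F)) × Misalignment cl cr) ℂ,
    IsChannel R ∧
    ∀ (a : Misalignment cl cr) (e p : Fin N → F), hammingNorm e ≤ tb → hammingNorm p ≤ tp →
      ∀ τ : Matrix ((Fin k → F) × (Fin (cl + cr) → F)) ((Fin k → F) × (Fin (cl + cr) → F)) ℂ,
        IsState τ →
          R (received V a e p * τ * (received V a e p)ᴴ) = τ ⊗ₖ Matrix.single a a 1

end QSync

end

/-!
# Quantum synchronizable codes of length `2 ^ n + cl + cr`

The code is of the type introduced by Fujiwara. Let `m = 2 ^ n`, and let `B ≤ A ≤ D` be linear codes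
of length `m` over `F`, with `D` cyclic and `g ∈ D`. A logical basis state is encoded as the uniform
superposition of a coset of `B` inside `A + g`, each word being extended periodically to
`m + cl + cr` symbols. For every misalignment, the middle `m` symbols of the receiver's window are
a cyclic shift of the transmitted word, up to bit errors, and hence a corrupted word of `D`. If `D`
has minimum distance above `2 tb`, this shifted word is known. If moreover words of `A + g` are
never nontrivial cyclic shifts of one another, the misalignment, the word, the bit error, and the
remaining symbols of the stream are all determined by the window (`window_extend_inj`). A phase
error on the block acts on the words as a phase error of no larger weight on `m` symbols
(`foldPhase_dotProduct`). Two such errors of weight at most `tp` send the code to orthogonal spaces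
if the dual of `B` has minimum distance above `2 tp`, because a nontrivial character sums to zero
over `B`. So all errors up to scalars belong to a family of isometries with mutually orthogonal
ranges, and one channel undoes them (`exists_channel_of_orthogonal_isometries`). Together this is
`exists_isQSC_of_codes`.

For the codes put `Q = 2 ^ (n - 3)`. As `4 Q` divides `q - 1`, the field `F` contains a root of unity
`ω` of order `4 Q`. Let `α` be a square root of `ω` in the algebraic closure, so that `α` has order
`m = 8 Q`. A zero `α ^ i` costs one check over `F` if `i` is even and at most two if `i` is odd, so
`2 Q` consecutive zeros cost `3 Q` checks. Let `A` be defined by the checks for `1 ≤ i ≤ 2 Q` and let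
`B` be spanned by the checks for `0 ≤ i < 2 Q`. Then `B ≤ A`, and
`dim A - dim B ≥ 5 Q - 3 Q = 2 ^ (n - 2)`, which leaves room for the logical qudits. The code `D` has
the zeros `α ^ i` for `2 ≤ i ≤ 2 Q`, and `g` is a word of `D` that does not vanish at `α`. Since all
words of `A` vanish at `α` and a cyclic shift by `a` multiplies the value at `α` by `α ^ (-a)`, the
shifts of `A + g` are disjoint. The distances follow from the BCH bound
(`eq_zero_of_spectralValue_eq_zero`): at least `2 Q` for `D` and at least `2 Q + 1` for the dual
of `B`.
-/

namespace QSync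

/-! ### Recovery from mutually orthogonal isometries -/

section Channel

variable {α σ β ι : Type*} [Fintype α] [DecidableEq α] [Fintype σ] [DecidableEq σ]
  [DecidableEq β]

/-- The isometry `|s⟩ ↦ |s⟩ ⊗ |b⟩` that attaches a classical label `b`. -/
def attachLabel (σ : Type*) [DecidableEq σ] (b : β) : Matrix (σ × β) σ ℂ :=
  Matrix.of fun sb s => if sb = (s, b) then 1 else 0

theorem attachLabel_conjTranspose_mul_self [Fintype β] (b : β) :
    (attachLabel σ b)ᴴ * attachLabel σ b = 1 := by
  ext s s'
  rw [Matrix.mul_apply, Finset.sum_eq_single (s, b)]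
  · simp [attachLabel, Matrix.one_apply]
  · intro x _ hx
    simp [attachLabel, hx]
  · simp

theorem attachLabel_mul_mul_conjTranspose (b : β) (τ : Matrix σ σ ℂ) :
    attachLabel σ b * τ * (attachLabel σ b)ᴴ = τ ⊗ₖ Matrix.single b b 1 := by
  ext ⟨s, c⟩ ⟨s', c'⟩
  rw [Matrix.mul_apply, Finset.sum_eq_single s', Matrix.mul_apply, Finset.sum_eq_single s]
  · by_cases h : c = b <;> by_cases h' : c' = b <;>
      simp [attachLabel, h, h', eq_comm (a := b)]
  · intro x _ hx
    simp [attachLabel, hx.symm]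
  · simp
  · intro x _ hx
    simp [attachLabel, hx.symm]
  · simp

/-- If the operators `T i` are isometries with mutually orthogonal ranges, then one channel undoes
all of them and reports a label of `i`: measure which range the state is in and invert `T i`.
On the orthogonal complement of the ranges, the channel resets to a fixed state. -/
theorem exists_channel_of_orthogonal_isometries [Fintype β] [Fintype ι] [DecidableEq ι]
    [Nonempty σ] [Nonempty β] (T : ι → Matrix α σ ℂ) (lab : ι → β)
    (hT : ∀ i j, (T i)ᴴ * T j = if i = j then 1 else 0) :
    ∃ R : Matrix α α ℂ → Matrix (σ × β) (σ × β) ℂ, IsChannel R ∧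
      ∀ i τ, R (T i * τ * (T i)ᴴ) = τ ⊗ₖ Matrix.single (lab i) (lab i) 1 := by
  obtain ⟨o⟩ : Nonempty (σ × β) := inferInstance
  set P : Matrix α α ℂ := ∑ i, T i * (T i)ᴴ with hP
  have hPT : ∀ j, P * T j = T j := by
    intro j
    rw [hP, Matrix.sum_mul, Finset.sum_eq_single j]
    · simp [Matrix.mul_assoc, hT]
    · intro i _ hi
      simp [Matrix.mul_assoc, hT, hi]
    · simp
  have hPP : P * P = P := by
    nth_rewrite 2 [hP]
    rw [Finset.mul_sum]
    simp only [← Matrix.mul_assoc, hPT]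
    rfl
  have hPh : Pᴴ = P := by
    simp [hP, Matrix.conjTranspose_sum]
  let K : ι ⊕ α → Matrix (σ × β) α ℂ := Sum.elim (fun i => attachLabel σ (lab i) * (T i)ᴴ)
    (fun z => Matrix.single o z (1 : ℂ) * (1 - P))
  have hK : ∑ x, (K x)ᴴ * K x = 1 := by
    have h1 : ∀ i, (attachLabel σ (lab i) * (T i)ᴴ)ᴴ * (attachLabel σ (lab i) * (T i)ᴴ)
        = T i * (T i)ᴴ := by
      intro i
      rw [Matrix.conjTranspose_mul, Matrix.conjTranspose_conjTranspose, Matrix.mul_assoc,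
        ← Matrix.mul_assoc (attachLabel σ (lab i))ᴴ, attachLabel_conjTranspose_mul_self,
        Matrix.one_mul]
    have h2 : ∀ z, (Matrix.single o z (1 : ℂ) * (1 - P))ᴴ * (Matrix.single o z (1 : ℂ) * (1 - P))
        = (1 - P) * (Matrix.single z z (1 : ℂ) * (1 - P)) := by
      intro z
      rw [Matrix.conjTranspose_mul, Matrix.conjTranspose_sub, hPh, Matrix.conjTranspose_one,
        Matrix.mul_assoc, ← Matrix.mul_assoc (Matrix.single o z (1 : ℂ))ᴴ]
      simp [Matrix.conjTranspose_single]
    have h3 : ∑ z : α, Matrix.single z z (1 : ℂ) = 1 := by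
      ext i j
      by_cases h : i = j
      · subst h
        simp [Matrix.sum_apply, Matrix.single_apply]
      · have : ∀ x, ¬(x = i ∧ x = j) := fun x hx => h (hx.1.symm.trans hx.2)
        simp [Matrix.sum_apply, h, this]
    simp only [K, Fintype.sum_sum_type, Sum.elim_inl, Sum.elim_inr, h1, h2]
    rw [← Matrix.mul_sum, ← Matrix.sum_mul, h3, Matrix.one_mul, ← hP, Matrix.sub_mul,
      Matrix.mul_sub, Matrix.mul_sub, hPP]
    simp
  let ε := Fintype.equivFin (ι ⊕ α)
  refine ⟨fun ρ => ∑ x, K x * ρ * (K x)ᴴ, ⟨_, fun r => K (ε.symm r), ?_, fun ρ => ?_⟩, ?_⟩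
  · rw [← hK]
    exact Equiv.sum_comp ε.symm fun x => (K x)ᴴ * K x
  · exact (Equiv.sum_comp ε.symm fun x => K x * ρ * (K x)ᴴ).symm
  · intro j τ
    have hinl : ∀ i, K (Sum.inl i) * T j = if i = j then attachLabel σ (lab j) else 0 := by
      intro i
      simp only [K, Sum.elim_inl, Matrix.mul_assoc, hT]
      split_ifs with h <;> simp [h]
    have hinr : ∀ z, K (Sum.inr z) * T j = 0 := by
      intro z
      simp only [K, Sum.elim_inr]
      rw [Matrix.mul_assoc, Matrix.sub_mul, hPT]
      simp
    have key : ∀ x, K x * (T j * τ * (T j)ᴴ) * (K x)ᴴ = K x * T j * τ * (K x * T j)ᴴ := by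
      intro x
      simp [Matrix.conjTranspose_mul, Matrix.mul_assoc]
    simp only [key, Fintype.sum_sum_type, hinl, hinr]
    rw [Finset.sum_eq_single j]
    · simp [attachLabel_mul_mul_conjTranspose]
    · intro i _ h
      simp [h]
    · simp

end Channel

/-! ### Superpositions of words -/

section Superposition

variable {α σ B : Type*} [Fintype α] [DecidableEq α] [Fintype B]

/-- The operator that sends `|s⟩` to the normalized superposition, over `b`, of the basis vectors
`|w b s⟩` with phases `φ b s`. -/
noncomputable def superposition (φ : B → σ → ℂ) (w : B → σ → α) : Matrix α σ ℂ :=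
  Matrix.of fun z s => (Real.sqrt (Fintype.card B) : ℂ)⁻¹ * ∑ b, φ b s * if z = w b s then 1 else 0

theorem superposition_conjTranspose_mul_apply (φ φ' : B → σ → ℂ) (w w' : B → σ → α) (s s' : σ) :
    ((superposition φ w)ᴴ * superposition φ' w') s s' =
      (Fintype.card B : ℂ)⁻¹ * ∑ b, ∑ b', star (φ b s) * φ' b' s' *
        if w b s = w' b' s' then 1 else 0 := by
  have hc : (Real.sqrt (Fintype.card B) : ℂ)⁻¹ * (Real.sqrt (Fintype.card B) : ℂ)⁻¹
      = (Fintype.card B : ℂ)⁻¹ := by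
    rw [← mul_inv, ← Complex.ofReal_mul, Real.mul_self_sqrt (by positivity)]
    simp
  simp only [superposition, Matrix.mul_apply, Matrix.conjTranspose_apply, Matrix.of_apply]
  rw [← hc]
  simp only [star_mul', star_sum, star_inv₀]
  have : star (Real.sqrt (Fintype.card B) : ℂ) = (Real.sqrt (Fintype.card B) : ℂ) := by simp
  rw [this]
  simp only [mul_mul_mul_comm _ _ ((Real.sqrt (Fintype.card B) : ℂ)⁻¹), ← Finset.mul_sum,
    Finset.sum_mul_sum]
  congr 1
  rw [Finset.sum_comm]
  refine Finset.sum_congr rfl fun b _ => ?_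
  rw [Finset.sum_eq_single (w b s)]
  · simp [Finset.mul_sum]
  · intro z _ hz
    simp [hz]
  · simp

theorem superposition_conjTranspose_mul_of_disjoint (φ φ' : B → σ → ℂ) (w w' : B → σ → α)
    (h : ∀ b s b' s', w b s ≠ w' b' s') :
    (superposition φ w)ᴴ * superposition φ' w' = 0 := by
  ext s s'
  simp [superposition_conjTranspose_mul_apply, h]

/-- Superpositions over the same words are compared through the inner products of their phases. -/
theorem superposition_conjTranspose_mul_of_injective [DecidableEq σ] (φ φ' : B → σ → ℂ)
    (w : B → σ → α) (h : ∀ b s b' s', w b s = w b' s' → b = b' ∧ s = s') :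
    (superposition φ w)ᴴ * superposition φ' w =
      Matrix.diagonal fun s => (Fintype.card B : ℂ)⁻¹ * ∑ b, star (φ b s) * φ' b s := by
  classical
  ext s s'
  rw [superposition_conjTranspose_mul_apply]
  by_cases hs : s = s'
  · subst hs
    rw [Matrix.diagonal_apply_eq]
    congr 1
    refine Finset.sum_congr rfl fun b _ => ?_
    rw [Finset.sum_eq_single b]
    · simp
    · intro b' _ hb
      rw [if_neg fun hw => hb (h _ _ _ _ hw).1.symm, mul_zero]
    · simp
  · rw [Matrix.diagonal_apply_ne _ hs]
    have : ∀ b b', w b s ≠ w b' s' := fun b b' hw => hs (h _ _ _ _ hw).2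
    simp [this]

end Superposition

/-! ### Phases -/

section Phase

variable {F : Type*} [Field F] [Fintype F]

theorem phaseChar_ne_one : phaseChar F ≠ 1 := by
  have : CharP F (ringChar F) := ringChar.charP F
  have : NeZero (ringChar F) := ⟨CharP.ringChar_ne_zero_of_finite F⟩
  have : Fact (ringChar F).Prime := ⟨CharP.char_is_prime F _⟩
  let : Algebra (ZMod (ringChar F)) F := ZMod.algebra F (ringChar F)
  obtain ⟨x, hx⟩ := Algebra.trace_surjective (ZMod (ringChar F)) F 1
  intro h
  have h1 : phaseChar F x = 1 := by rw [h]; rfl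
  have h2 : phaseChar F x = ZMod.stdAddChar (N := ringChar F) 1 := by
    rw [← hx]; rfl
  rw [h2, ← AddChar.map_zero_eq_one (ZMod.stdAddChar (N := ringChar F))] at h1
  exact one_ne_zero (ZMod.injective_stdAddChar h1)

theorem star_phaseChar_mul (x y : F) :
    star (phaseChar F x) * phaseChar F y = phaseChar F (y - x) := by
  have : star (phaseChar F x) = phaseChar F (-x) := (AddChar.map_neg_eq_conj _ _).symm
  rw [this, ← AddChar.map_add_eq_mul]
  congr 1
  ring

/-- A character of the form `b ↦ χ (p · b)` sums to zero over a subspace to which `p` is not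
orthogonal. -/
theorem sum_phaseChar_dotProduct_eq_zero {ι : Type*} [Fintype ι] (B : Submodule F (ι → F))
    [Fintype B] (p : ι → F) (h : ∃ b ∈ B, p ⬝ᵥ b ≠ 0) :
    ∑ b : B, phaseChar F (p ⬝ᵥ (b : ι → F)) = 0 := by
  let f : B →+ F := AddMonoidHom.mk' (fun b => p ⬝ᵥ (b : ι → F)) fun b b' => by
    simp [dotProduct_add]
  have hψ : (phaseChar F).compAddMonoidHom f ≠ 0 := by
    obtain ⟨x, hx⟩ := AddChar.ne_one_iff.1 (phaseChar_ne_one (F := F))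
    obtain ⟨b, hb, hpb⟩ := h
    refine AddChar.ne_one_iff.2 ⟨(x / (p ⬝ᵥ b)) • ⟨b, hb⟩, ?_⟩
    have : f ((x / (p ⬝ᵥ b)) • ⟨b, hb⟩) = x := by
      simp [f, dotProduct_smul, hpb]
    rw [AddChar.compAddMonoidHom_apply, this]
    exact hx
  exact AddChar.sum_eq_zero_iff_ne_zero.2 hψ

end Phase

/-! ### Weights -/

section Weight

variable {ι κ F : Type*} [Fintype ι] [Fintype κ] [AddCommGroup F] [DecidableEq F]

theorem hammingNorm_comp_le (x : κ → F) {f : ι → κ} (hf : Function.Injective f) :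
    hammingNorm (fun i => x (f i)) ≤ hammingNorm x := by
  classical
  refine Finset.card_le_card_of_injOn f (fun i hi => ?_) hf.injOn
  simpa using hi

theorem hammingNorm_sub_le (x y : ι → F) :
    hammingNorm (x - y) ≤ hammingNorm x + hammingNorm y := by
  have h := hammingDist_triangle y 0 x
  rwa [hammingDist_zero_right, hammingDist_zero_left, hammingDist_eq_hammingNorm,
    neg_add_eq_sub, add_comm] at h

end Weight

/-! ### Periodic extension of words -/

section Extend

variable {F : Type*} {m : ℕ}

/-- The block of `N` symbols that repeats the word `x` of length `m` periodically. -/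
def extend (N : ℕ) (x : ZMod m → F) : Fin N → F := fun j => x (j : ℕ)

theorem extend_injective {N : ℕ} [NeZero m] (h : m ≤ N) :
    Function.Injective (extend N : (ZMod m → F) → Fin N → F) := by
  intro x x' hx
  ext i
  have := congrFun hx ⟨i.val, (ZMod.val_lt i).trans_le h⟩
  simpa [extend] using this

/-- The phase error on the word of length `m` that has the same effect as the phase error `p` on its
periodic extension. -/
def foldPhase [AddCommMonoid F] {N : ℕ} (p : Fin N → F) : ZMod m → F :=
  fun i => ∑ j ∈ Finset.univ.filter fun j : Fin N => ((j : ℕ) : ZMod m) = i, p j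

theorem foldPhase_dotProduct [CommSemiring F] {N : ℕ} [NeZero m] (p : Fin N → F) (x : ZMod m → F) :
    foldPhase p ⬝ᵥ x = p ⬝ᵥ extend N x := by
  simp only [dotProduct, foldPhase, extend, Finset.sum_mul]
  rw [← Finset.sum_fiberwise Finset.univ (fun j : Fin N => ((j : ℕ) : ZMod m))]
  refine Finset.sum_congr rfl fun i _ => Finset.sum_congr rfl fun j hj => ?_
  rw [(Finset.mem_filter.1 hj).2]

theorem hammingNorm_foldPhase_le {N : ℕ} [NeZero m] [AddCommMonoid F] [DecidableEq F] (p : Fin N → F) :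
    hammingNorm (foldPhase p : ZMod m → F) ≤ hammingNorm p := by
  classical
  refine le_trans (Finset.card_le_card ?_)
    (Finset.card_image_le (s := {j | p j ≠ 0}) (f := fun j : Fin N => ((j : ℕ) : ZMod m)))
  intro i hi
  obtain ⟨j, hj, hpj⟩ := Finset.exists_ne_zero_of_sum_ne_zero (Finset.mem_filter.1 hi).2
  exact Finset.mem_image.2 ⟨j, by simpa using hpj, (Finset.mem_filter.1 hj).2⟩

end Extend

/-! ### Decoding the receiver's window -/

section Window

variable {F : Type*} {cl cr : ℕ}

theorem offset_injective : Function.Injective (offset : Misalignment cl cr → ℕ) := by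
  intro a b h
  have ha := Finset.mem_Icc.1 a.2
  have hb := Finset.mem_Icc.1 b.2
  unfold offset at h
  ext
  omega

theorem window_block {N : ℕ} (a : Misalignment cl cr) (x : Fin N → F) (y : Fin (cl + cr) → F)
    (j : Fin N) (h : offset a + j < N + (cl + cr)) :
    window a x y ⟨offset a + j, h⟩ = x j := by
  have h1 : ¬ offset a + (j : ℕ) < offset a := by omega
  have h2 : offset a + (j : ℕ) < offset a + N := by omega
  simp [window]

theorem window_inj {N : ℕ} {a : Misalignment cl cr} {x x' : Fin N → F}
    {y y' : Fin (cl + cr) → F} (h : window a x y = window a x' y') : x = x' ∧ y = y' := by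
  have ho := offset_le a
  constructor
  · ext j
    have hj : offset a + (j : ℕ) < N + (cl + cr) := by omega
    rw [← window_block a x y j hj, h, window_block]
  · ext j
    by_cases hj : (j : ℕ) < offset a
    · have := congrFun h ⟨j, by omega⟩
      simpa [window, hj] using this
    · have := congrFun h ⟨(j : ℕ) + N, by omega⟩
      have h1 : ¬ (j : ℕ) + N < offset a := by omega
      have h2 : ¬ (j : ℕ) + N < offset a + N := by omega
      simpa only [window, h1, h2, dite_false, Nat.add_sub_cancel] using this

/-- The window determines everything. Its middle `m` symbols belong to the block for every
misalignment, and they form a cyclic shift of the transmitted word with at most `tb` errors. The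
cyclic code `D` corrects these errors, and the shift reveals the misalignment. -/
theorem window_extend_inj [Field F] [DecidableEq F] {m tb : ℕ} [NeZero m] (D : Submodule F (ZMod m → F))
    (S : Set (ZMod m → F)) (hlr : cl + cr < m)
    (hD : ∀ x ∈ D, hammingNorm x ≤ 2 * tb → x = 0)
    (hshift : ∀ x ∈ D, ∀ a, (fun i => x (i + a)) ∈ D) (hSD : ∀ x ∈ S, x ∈ D)
    (hsync : ∀ x ∈ S, ∀ x' ∈ S, ∀ a b, (∀ i, x (i + a) = x' (i + b)) → a = b)
    {a a' : Misalignment cl cr} {x x' : ZMod m → F} (hx : x ∈ S) (hx' : x' ∈ S)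
    {e e' : Fin (m + cl + cr) → F} (he : hammingNorm e ≤ tb) (he' : hammingNorm e' ≤ tb)
    {y y' : Fin (cl + cr) → F}
    (h : window a (extend _ x + e) y = window a' (extend _ x' + e') y') :
    a = a' ∧ x = x' ∧ e = e' ∧ y = y' := by
  have ho := offset_le a
  have ho' := offset_le a'
  -- the place of the window's middle part in the block
  set s := cl + cr - offset a with hs
  set s' := cl + cr - offset a' with hs'
  have hbound : ∀ i : ZMod m, s + i.val < m + cl + cr := fun i => by
    have := ZMod.val_lt i
    omega
  have hbound' : ∀ i : ZMod m, s' + i.val < m + cl + cr := fun i => by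
    have := ZMod.val_lt i
    omega
  have hmid : ∀ i : ZMod m, x (i + s) + e ⟨s + i.val, hbound i⟩
      = x' (i + s') + e' ⟨s' + i.val, hbound' i⟩ := by
    intro i
    have hi := ZMod.val_lt i
    have h1 := window_block a (extend _ x + e) y ⟨s + i.val, hbound i⟩
      (by simp only [hs]; omega)
    have h2 := window_block a' (extend _ x' + e') y' ⟨s' + i.val, hbound' i⟩
      (by simp only [hs']; omega)
    have h3 : offset a + (s + i.val) = offset a' + (s' + i.val) := by omega
    simp only [h3] at h1
    rw [h, h2] at h1
    simpa [extend, add_comm] using h1.symm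
  set u : ZMod m → F := (fun i => x (i + s)) - fun i => x' (i + s') with hu
  have hu' : u = (fun i => e' ⟨s' + i.val, hbound' i⟩) - fun i => e ⟨s + i.val, hbound i⟩ := by
    ext i
    have := hmid i
    simp only [hu, Pi.sub_apply]
    linear_combination this
  have hwt : hammingNorm u ≤ 2 * tb := by
    rw [hu']
    refine (hammingNorm_sub_le _ _).trans ?_
    have h1 := hammingNorm_comp_le e' (f := fun i : ZMod m => ⟨s' + i.val, hbound' i⟩)
      fun i j hij => ZMod.val_injective m (by simpa using hij)
    have h2 := hammingNorm_comp_le e (f := fun i : ZMod m => ⟨s + i.val, hbound i⟩)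
      fun i j hij => ZMod.val_injective m (by simpa using hij)
    omega
  have hu0 : u = 0 :=
    hD u (D.sub_mem (hshift x (hSD x hx) _) (hshift x' (hSD x' hx') _)) hwt
  have hxx : ∀ i, x (i + s) = x' (i + s') := fun i => by
    have := congrFun hu0 i
    simpa [hu, sub_eq_zero] using this
  have hss : s = s' := by
    have h1 := congrArg ZMod.val (hsync x hx x' hx' _ _ hxx)
    rwa [ZMod.val_natCast_of_lt (by omega), ZMod.val_natCast_of_lt (by omega)] at h1
  have haa : a = a' := offset_injective (by omega)
  subst haa
  have hx0 : x = x' := by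
    ext i
    have := hxx (i - s)
    rwa [← hss, sub_add_cancel] at this
  subst hx0
  obtain ⟨h1, h2⟩ := window_inj h
  exact ⟨rfl, rfl, add_left_cancel h1, h2⟩

end Window

/-! ### The encoder -/

section Encoder

variable {F : Type*} [Field F] [Fintype F] [DecidableEq F] {B : Type*} [Fintype B]

theorem received_superposition {cl cr N k : ℕ} (u : B → (Fin k → F) → Fin N → F)
    (a : Misalignment cl cr) (e p : Fin N → F) :
    received (superposition (fun _ _ => 1) u) a e p =
      superposition (fun b sy => phaseChar F (p ⬝ᵥ u b sy.1))
        (fun b (sy : (Fin k → F) × (Fin (cl + cr) → F)) => window a (u b sy.1 + e) sy.2) := by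
  have hmul : ∀ w s, (bitError e * phaseError p * superposition (fun _ _ => 1) u :
      Matrix (Fin N → F) (Fin k → F) ℂ) w s = (Real.sqrt (Fintype.card B) : ℂ)⁻¹ *
        ∑ b, phaseChar F (p ⬝ᵥ u b s) * if w = u b s + e then 1 else 0 := by
    intro w s
    rw [Matrix.mul_apply]
    simp only [bitError, phaseError, Matrix.mul_diagonal, Matrix.of_apply, superposition, one_mul,
      mul_left_comm _ ((Real.sqrt (Fintype.card B) : ℂ)⁻¹), ← Finset.mul_sum]
    congr 1
    simp only [Finset.mul_sum]
    rw [Finset.sum_comm]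
    refine Finset.sum_congr rfl fun b _ => ?_
    rw [Finset.sum_eq_single (u b s)]
    · simp [mul_comm]
    · intro v _ hv
      simp [hv]
    · simp
  ext z ⟨s, y⟩
  rw [received, Matrix.mul_apply, Fintype.sum_prod_type]
  simp only [Matrix.kroneckerMap_apply, hmul]
  simp only [windowMatrix, Matrix.of_apply, superposition, Matrix.one_apply]
  have h1 : ∀ w, (∑ y' : Fin (cl + cr) → F, (if z = window a w y' then (1 : ℂ) else 0) *
      ((Real.sqrt (Fintype.card B) : ℂ)⁻¹ * (∑ b, phaseChar F (p ⬝ᵥ u b s) *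
        if w = u b s + e then 1 else 0) * if y' = y then 1 else 0)) =
      (Real.sqrt (Fintype.card B) : ℂ)⁻¹ * ∑ b, phaseChar F (p ⬝ᵥ u b s) *
        ((if z = window a w y then (1 : ℂ) else 0) * if w = u b s + e then 1 else 0) := by
    intro w
    rw [Finset.sum_eq_single y]
    · simp only [if_true, mul_one, Finset.mul_sum]
      exact Finset.sum_congr rfl fun b _ => by ring
    · intro y' _ hy
      simp [hy]
    · simp
  simp only [h1, ← Finset.mul_sum]
  congr 1
  rw [Finset.sum_comm]
  refine Finset.sum_congr rfl fun b _ => ?_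
  rw [Finset.sum_eq_single (u b s + e)]
  · simp
  · intro w _ hw
    simp [hw]
  · simp

/-- The quantum synchronizable code of a chain of codes `B ≤ A ≤ D` of length `m`, of which `D` is
cyclic, and a vector `g` of `D`. The logical state `s` is encoded in the coset `L s + g + B` inside
`A + g`, and the words are extended periodically by `cl + cr` symbols.
Bit errors are corrected by `D` and phase errors by the dual code of `B`. No two words of `A + g`
are related by a nontrivial cyclic shift, which synchronizes the receiver. -/
theorem exists_isQSC_of_codes {m k cl cr tb tp : ℕ} [NeZero m] (hlr : cl + cr < m)
    (A B D : Submodule F (ZMod m → F)) (g : ZMod m → F) (L : (Fin k → F) →ₗ[F] ZMod m → F)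
    (hBA : B ≤ A) (hAD : A ≤ D) (hg : g ∈ D) (hLA : ∀ s, L s ∈ A) (hLB : ∀ s, L s ∈ B → s = 0)
    (hD : ∀ x ∈ D, hammingNorm x ≤ 2 * tb → x = 0)
    (hshift : ∀ x ∈ D, ∀ a, (fun i => x (i + a)) ∈ D)
    (hsync : ∀ x ∈ A, ∀ x' ∈ A, ∀ a b, (∀ i, (x + g) (i + a) = (x' + g) (i + b)) → a = b)
    (hB : ∀ p : ZMod m → F, (∀ b ∈ B, p ⬝ᵥ b = 0) → hammingNorm p ≤ 2 * tp → p = 0) :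
    ∃ V : Matrix (Fin (m + cl + cr) → F) (Fin k → F) ℂ, IsQSC cl cr tb tp V := by
  classical
  let G : B → (Fin k → F) → ZMod m → F := fun b s => b + L s + g
  have hG : ∀ b s b' s', G b s = G b' s' → b = b' ∧ s = s' := by
    intro b s b' s' h
    have h1 : (b : ZMod m → F) + L s = b' + L s' := add_right_cancel h
    have h2 : L (s - s') = ((b' - b : B) : ZMod m → F) := by
      rw [map_sub, Submodule.coe_sub]
      linear_combination (exp := 1) h1
    have h3 : s = s' := sub_eq_zero.1 (hLB _ (by rw [h2]; exact (b' - b).2))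
    subst h3
    exact ⟨Subtype.ext (add_right_cancel h1), rfl⟩
  have hext : ∀ b s b' s', extend (m + cl + cr) (G b s) = extend _ (G b' s') → b = b' ∧ s = s' :=
    fun b s b' s' h => hG _ _ _ _ (extend_injective (by omega) h)
  have hcard : (Fintype.card B : ℂ) ≠ 0 := by exact_mod_cast Fintype.card_ne_zero
  let S : Set (ZMod m → F) := {x | ∃ x₀ ∈ A, x = x₀ + g}
  have hGS : ∀ b s, G b s ∈ S := fun b s => ⟨b + L s, A.add_mem (hBA b.2) (hLA s), rfl⟩
  -- the correctable errors: misalignment, bit error, and folded phase error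
  let ι := {i : Misalignment cl cr × (Fin (m + cl + cr) → F) × (ZMod m → F) //
    hammingNorm i.2.1 ≤ tb ∧ hammingNorm i.2.2 ≤ tp}
  let W : Misalignment cl cr → (Fin (m + cl + cr) → F) → B →
      (Fin k → F) × (Fin (cl + cr) → F) → Fin (m + cl + cr + (cl + cr)) → F :=
    fun a e b sy => window a (extend _ (G b sy.1) + e) sy.2
  have hW : ∀ a e b sy a' e' b' sy', hammingNorm e ≤ tb → hammingNorm e' ≤ tb →
      W a e b sy = W a' e' b' sy' → a = a' ∧ e = e' ∧ b = b' ∧ sy = sy' := by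
    intro a e b sy a' e' b' sy' he he' h
    obtain ⟨h1, h2, h3, h4⟩ := window_extend_inj D S hlr hD hshift
      (by rintro _ ⟨x, hx, rfl⟩; exact D.add_mem (hAD hx) hg)
      (by rintro _ ⟨x, hx, rfl⟩ _ ⟨x', hx', rfl⟩; exact hsync x hx x' hx')
      (hGS b sy.1) (hGS b' sy'.1) he he' h
    obtain ⟨h5, h6⟩ := hG _ _ _ _ h2
    exact ⟨h1, h3, h5, Prod.ext h6 h4⟩
  let T : ι → Matrix (Fin (m + cl + cr + (cl + cr)) → F)
      ((Fin k → F) × (Fin (cl + cr) → F)) ℂ := fun i =>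
    superposition (fun b sy => phaseChar F (i.1.2.2 ⬝ᵥ G b sy.1)) (W i.1.1 i.1.2.1)
  have hT : ∀ i j, (T i)ᴴ * T j = if i = j then 1 else 0 := by
    rintro ⟨⟨a, e, p⟩, he, hp⟩ ⟨⟨a', e', p'⟩, he', hp'⟩
    by_cases hae : a = a' ∧ e = e'
    · obtain ⟨rfl, rfl⟩ := hae
      simp only [T]
      rw [superposition_conjTranspose_mul_of_injective _ _ _
        fun b s b' s' h => (hW _ _ _ _ _ _ _ _ he he h).2.2]
      by_cases hpp : p = p'
      · subst hpp
        rw [if_pos rfl]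
        simp only [star_phaseChar_mul, sub_self, AddChar.map_zero_eq_one]
        ext sy sy'
        simp [Matrix.diagonal_apply, Matrix.one_apply, hcard]
      · rw [if_neg fun h => hpp (congrArg (fun i : ι => i.1.2.2) h)]
        have hex : ∃ b ∈ B, (p' - p) ⬝ᵥ b ≠ 0 := by
          by_contra! hall
          refine hpp (sub_eq_zero.1 (hB _ hall ?_)).symm
          have := hammingNorm_sub_le p' p
          simp only at hp hp'
          omega
        rw [← Matrix.diagonal_zero]
        congr 1
        ext sy
        simp only [star_phaseChar_mul, ← sub_dotProduct]
        simp only [G, dotProduct_add, AddChar.map_add_eq_mul,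
          ← Finset.sum_mul, sum_phaseChar_dotProduct_eq_zero B (p' - p) hex]
        simp
    · rw [if_neg fun h => hae ⟨congrArg (fun i : ι => i.1.1) h,
        congrArg (fun i : ι => i.1.2.1) h⟩]
      refine superposition_conjTranspose_mul_of_disjoint _ _ _ _ fun b s b' s' h => hae ?_
      obtain ⟨h1, h2, -⟩ := hW _ _ _ _ _ _ _ _ he he' h
      exact ⟨h1, h2⟩
  have : Nonempty (Misalignment cl cr) := ⟨⟨0, by simp⟩⟩
  obtain ⟨R, hR, hRT⟩ := exists_channel_of_orthogonal_isometries T (fun i => i.1.1) hT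
  refine ⟨superposition (fun _ _ => 1) fun b s => extend _ (G b s), ?_, R, hR, ?_⟩
  · rw [superposition_conjTranspose_mul_of_injective _ _ _ hext]
    ext s s'
    simp [Matrix.diagonal_apply, Matrix.one_apply, hcard]
  · intro a e p he hp τ _
    let i : ι := ⟨(a, e, foldPhase p), he, (hammingNorm_foldPhase_le p).trans hp⟩
    have h : received (superposition (fun _ _ => 1) fun b s => extend _ (G b s)) a e p = T i := by
      rw [received_superposition]
      simp only [T, i, W, foldPhase_dotProduct]
    rw [h]
    exact hRT i τ

end Encoder

/-! ### Linear algebra of the codes -/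

section LinearAlgebra

/-- Vandermonde form of the BCH bound. -/
theorem eq_zero_of_consecutive_zeros {ι K : Type*} [Fintype ι] [Field K] [DecidableEq K]
    {f : ι → K} (hf : Function.Injective f) (hf0 : ∀ j, f j ≠ 0) (x : ι → K) (s w : ℕ)
    (hx : ∀ i, s ≤ i → i < s + w → ∑ j, x j * f j ^ i = 0) (hw : hammingNorm x ≤ w) : x = 0 := by
  classical
  let S : Finset ι := {j | x j ≠ 0}
  let ε := S.equivFin
  have hv : (fun r => x (ε.symm r) * f (ε.symm r) ^ s) = 0 := by
    refine Matrix.eq_zero_of_forall_pow_sum_mul_pow_eq_zero (f := fun r => f (ε.symm r))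
      (fun r r' h => ε.symm.injective (Subtype.ext (hf h))) fun i => ?_
    have hi : (i : ℕ) < w := i.2.trans_le hw
    rw [← hx (s + i) (by omega) (by omega), ε.symm.sum_comp
      (fun j : S => x j * f j ^ s * f j ^ (i : ℕ)), Finset.sum_coe_sort S
      (fun j => x j * f j ^ s * f j ^ (i : ℕ))]
    simp only [mul_assoc, ← pow_add]
    refine Finset.sum_subset (Finset.subset_univ S) fun j _ hj => ?_
    have : x j = 0 := by simpa [S] using hj
    simp [this]
  ext j
  by_contra hj
  have hjS : j ∈ S := by simpa [S] using hj
  have h := congrFun hv (ε ⟨j, hjS⟩)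
  simp only [Equiv.symm_apply_apply, Pi.zero_apply, mul_eq_zero] at h
  exact h.elim hj (pow_ne_zero _ (hf0 j))

theorem exists_linearMap_of_finrank_le {F M : Type*} [Field F] [AddCommGroup M] [Module F M]
    [FiniteDimensional F M] {A B : Submodule F M} (hBA : B ≤ A) {k : ℕ}
    (h : k + Module.finrank F B ≤ Module.finrank F A) :
    ∃ L : (Fin k → F) →ₗ[F] M, (∀ s, L s ∈ A) ∧ ∀ s, L s ∈ B → s = 0 := by
  have h1 := Submodule.finrank_quotient_add_finrank (B.submoduleOf A)
  rw [(Submodule.submoduleOfEquivOfLe hBA).finrank_eq] at h1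
  obtain ⟨f, hf⟩ := (finrank_le_iff_exists_linearMap (R := F) (M := Fin k → F)
    (M' := A ⧸ B.submoduleOf A)).1 (by rw [Module.finrank_fin_fun]; omega)
  obtain ⟨r, hr⟩ := (B.submoduleOf A).mkQ.exists_rightInverse_of_surjective
    (Submodule.range_mkQ _)
  refine ⟨A.subtype ∘ₗ r ∘ₗ f, fun s => (r (f s)).2, fun s hs => hf ?_⟩
  have h2 : (B.submoduleOf A).mkQ (r (f s)) = 0 := by
    rw [Submodule.mkQ_apply, Submodule.Quotient.mk_eq_zero]
    exact hs
  rw [map_zero, ← h2]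
  exact (LinearMap.congr_fun hr (f s)).symm

end LinearAlgebra

/-! ### Check vectors -/

section CheckVector

variable {F : Type*} [Field F] {m : ℕ}

/-- The word `(a, b, a ω^i, b ω^i, a ω^(2i), b ω^(2i), …)` of length `m`. -/
def checkVector (m : ℕ) (ω : F) (i : ℕ) (a b : F) : ZMod m → F :=
  fun j => (if j.val % 2 = 0 then a else b) * ω ^ (i * (j.val / 2))

theorem checkVector_add_two {M : ℕ} [NeZero m] (hm : m = 2 * M) (hM : 1 < M) {ω : F}
    (hω : ω ^ M = 1) (i : ℕ) (a b : F) (j : ZMod m) :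
    checkVector m ω i a b (j + 2) = ω ^ i * checkVector m ω i a b j := by
  have h2 : (2 : ZMod m).val = 2 := ZMod.val_natCast_of_lt (a := 2) (by omega)
  have hj := ZMod.val_lt j
  rcases lt_or_ge (j.val + 2) m with h | h
  · have hv : (j + 2).val = j.val + 2 := by
      rw [ZMod.val_add, h2, Nat.mod_eq_of_lt h]
    have hd : (j.val + 2) / 2 = j.val / 2 + 1 := by omega
    simp only [checkVector, hv, hd, Nat.add_mod_right]
    ring
  · -- the index wraps around
    have hv : (j + 2).val = j.val + 2 - m := by
      rw [ZMod.val_add, h2, Nat.mod_eq_sub_mod h, Nat.mod_eq_of_lt (by omega)]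
    have hd : j.val / 2 + 1 = (j.val + 2 - m) / 2 + M := by omega
    have hp : (j.val + 2 - m) % 2 = j.val % 2 := by omega
    have : ω ^ i * ω ^ (i * (j.val / 2)) = ω ^ (i * ((j.val + 2 - m) / 2)) := by
      rw [← pow_add, show i + i * (j.val / 2) = i * ((j.val + 2 - m) / 2) + M * i by
        linear_combination i * hd, pow_add, pow_mul ω M, hω, one_pow, mul_one]
    simp only [checkVector, hv, hp]
    rw [← this]
    ring

theorem sum_eq_zero_of_add_right [NeZero m] {K : Type*} [Field K] {f : ZMod m → K} {c : K}
    (d : ZMod m) (hf : ∀ j, f (j + d) = c * f j) (hc : c ≠ 1) : ∑ j, f j = 0 := by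
  have h : ∑ j, f j = c * ∑ j, f j := by
    rw [Finset.mul_sum, ← Equiv.sum_comp (Equiv.addRight d) f]
    exact Finset.sum_congr rfl fun j _ => hf j
  by_contra h0
  exact hc (mul_right_cancel₀ h0 (by rw [← h, one_mul]))

/-- Check vectors over `F` whose orthogonality to a word forces the zeros `α ^ i`,
`s ≤ i < s + 2 Q`, where `s ≤ 1` and `α` is a square root of `ω` in an extension field. For even `i`
the power `α ^ i` lies in `F` and one check suffices. For odd `i` two checks make the contributions
of the even and the odd places vanish separately. Each zero of even exponent thus costs one
dimension, each zero of odd exponent two. -/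
def checks (m : ℕ) (ω : F) (s Q : ℕ) : Fin Q × Fin 3 → ZMod m → F := fun κ =>
  ![checkVector m ω (2 * (κ.1 + s)) 1 (ω ^ (κ.1 + s)), checkVector m ω (2 * κ.1 + 1) 1 0,
    checkVector m ω (2 * κ.1 + 1) 0 1] κ.2

theorem exists_checks_eq (m : ℕ) (ω : F) {s Q : ℕ} (hs : s ≤ 1) (κ : Fin Q × Fin 3) :
    ∃ i a b, s ≤ i ∧ i < s + 2 * Q ∧ checks m ω s Q κ = checkVector m ω i a b := by
  obtain ⟨t, c⟩ := κ
  have ht := t.2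
  fin_cases c
  · exact ⟨2 * (t + s), _, _, by omega, by omega, rfl⟩
  · exact ⟨2 * t + 1, _, _, by omega, by omega, rfl⟩
  · exact ⟨2 * t + 1, _, _, by omega, by omega, rfl⟩

/-- The checks with exponents `i` in `[1, 2 Q]` are orthogonal to those with exponents `i'` in
`[0, 2 Q)`: moving the summation index by two multiplies the inner product by `ω ^ (i + i')`, which
is not one because `0 < i + i' < 4 Q`. -/
theorem checks_dotProduct_checks {Q : ℕ} [NeZero m] [NeZero Q] (hm : m = 8 * Q) {ω : F}
    (hω : IsPrimitiveRoot ω (4 * Q)) (κ κ' : Fin Q × Fin 3) :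
    checks m ω 1 Q κ ⬝ᵥ checks m ω 0 Q κ' = 0 := by
  have hQ := NeZero.pos Q
  obtain ⟨i, a, b, hi, hi', h⟩ := exists_checks_eq m ω le_rfl κ
  obtain ⟨i', a', b', -, hi'', h'⟩ := exists_checks_eq m ω zero_le_one κ'
  rw [h, h']
  refine sum_eq_zero_of_add_right (c := ω ^ (i + i')) 2 (fun j => ?_)
    (hω.pow_ne_one_of_pos_of_lt (by omega) (by omega))
  rw [checkVector_add_two (M := 4 * Q) (by omega) (by omega) hω.pow_eq_one,
    checkVector_add_two (M := 4 * Q) (by omega) (by omega) hω.pow_eq_one]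
  ring

/-- The words that satisfy the checks of the zeros `α ^ i`, `1 ≤ i ≤ 2 Q`. -/
def codeA (m : ℕ) [NeZero m] (ω : F) (Q : ℕ) : Submodule F (ZMod m → F) :=
  LinearMap.ker (Matrix.mulVecLin (Matrix.of (checks m ω 1 Q)))

/-- The span of the checks of the zeros `α ^ i`, `0 ≤ i < 2 Q`, so that the words orthogonal to it
have these zeros. -/
def codeB (m : ℕ) (ω : F) (Q : ℕ) : Submodule F (ZMod m → F) :=
  Submodule.span F (Set.range (checks m ω 0 Q))

theorem mem_codeA {Q : ℕ} [NeZero m] {ω : F} {x : ZMod m → F} :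
    x ∈ codeA m ω Q ↔ ∀ κ, checks m ω 1 Q κ ⬝ᵥ x = 0 := by
  simp [codeA, funext_iff, Matrix.mulVec]

theorem codeB_le_codeA {Q : ℕ} [NeZero m] [NeZero Q] (hm : m = 8 * Q) {ω : F}
    (hω : IsPrimitiveRoot ω (4 * Q)) : codeB m ω Q ≤ codeA m ω Q := by
  rw [codeB, Submodule.span_le]
  rintro _ ⟨κ', rfl⟩
  exact mem_codeA.2 fun κ => checks_dotProduct_checks hm hω κ κ'

theorem finrank_codeB_le (m : ℕ) (ω : F) (Q : ℕ) : Module.finrank F (codeB m ω Q) ≤ 3 * Q := by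
  refine (finrank_range_le_card (checks m ω 0 Q)).trans_eq ?_
  simp [mul_comm]

theorem le_finrank_codeA {Q : ℕ} [NeZero m] (hm : m = 8 * Q) (ω : F) :
    5 * Q ≤ Module.finrank F (codeA m ω Q) := by
  have h1 := LinearMap.finrank_range_add_finrank_ker
    (Matrix.mulVecLin (Matrix.of (checks m ω 1 Q)))
  have h2 := Submodule.finrank_le (LinearMap.range (Matrix.mulVecLin (Matrix.of (checks m ω 1 Q))))
  simp only [Module.finrank_fintype_fun_eq_card, Fintype.card_prod, Fintype.card_fin,
    ZMod.card] at h1 h2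
  rw [codeA]
  omega

end CheckVector

/-! ### Spectra of words -/

section Spectrum

variable {F K : Type*} [Field F] [Field K] [Algebra F K] {m : ℕ} [NeZero m] {α : K}

/-- The value of the polynomial `∑ x_j X^j` at `α ^ i`, where `α ^ m = 1`. -/
def spectralValue (hα : α ^ m = 1) (i : ℕ) (x : ZMod m → F) : K :=
  ∑ j, algebraMap F K (x j) * AddChar.zmodChar m hα j ^ i

theorem spectralValue_add (hα : α ^ m = 1) (i : ℕ) (x y : ZMod m → F) :
    spectralValue hα i (x + y) = spectralValue hα i x + spectralValue hα i y := by
  simp [spectralValue, add_mul, Finset.sum_add_distrib]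

theorem spectralValue_shift (hα : α ^ m = 1) (i : ℕ) (x : ZMod m → F) (a : ZMod m) :
    spectralValue hα i (fun j => x (j + a)) =
      AddChar.zmodChar m hα (-a) ^ i * spectralValue hα i x := by
  simp only [spectralValue]
  rw [Finset.mul_sum, ← Equiv.sum_comp (Equiv.addRight a) fun j =>
    AddChar.zmodChar m hα (-a) ^ i * (algebraMap F K (x j) * AddChar.zmodChar m hα j ^ i)]
  refine Finset.sum_congr rfl fun j _ => ?_
  rw [mul_left_comm, ← mul_pow, ← AddChar.map_add_eq_mul]
  simp

theorem zmodChar_injective (hα : IsPrimitiveRoot α m) :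
    Function.Injective (AddChar.zmodChar m hα.pow_eq_one) := by
  intro a b h
  exact ZMod.val_injective m (hα.pow_inj (ZMod.val_lt a) (ZMod.val_lt b) h)

/-- The BCH bound. -/
theorem eq_zero_of_spectralValue_eq_zero [DecidableEq F] (hα : IsPrimitiveRoot α m)
    (x : ZMod m → F) (s w : ℕ)
    (hx : ∀ i, s ≤ i → i < s + w → spectralValue hα.pow_eq_one i x = 0)
    (hw : hammingNorm x ≤ w) : x = 0 := by
  classical
  have h0 : ∀ j, AddChar.zmodChar m hα.pow_eq_one j ≠ 0 := fun j =>
    pow_ne_zero _ (hα.ne_zero (NeZero.ne m))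
  have h := eq_zero_of_consecutive_zeros (zmodChar_injective hα) h0 (fun j => algebraMap F K (x j))
    s w hx (le_trans (le_of_eq (hammingNorm_comp (fun _ => algebraMap F K)
      (fun _ => (algebraMap F K).injective) (fun _ => map_zero _))) hw)
  ext j
  exact (algebraMap F K).injective (by simpa using congrFun h j)

theorem zmodChar_pow {ω : F} (hα : α ^ m = 1) (hαω : α ^ 2 = algebraMap F K ω) (i : ℕ)
    (j : ZMod m) : AddChar.zmodChar m hα j ^ i =
      α ^ (i * (j.val % 2)) * algebraMap F K (ω ^ (i * (j.val / 2))) := by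
  rw [AddChar.zmodChar_apply, ← pow_mul, map_pow, ← hαω, ← pow_mul, ← pow_add]
  congr 1
  conv_lhs => rw [← Nat.mod_add_div j.val 2]
  ring

theorem spectralValue_even {ω : F} (hα : α ^ m = 1) (hαω : α ^ 2 = algebraMap F K ω) (t : ℕ)
    (x : ZMod m → F) : spectralValue hα (2 * t) x =
      algebraMap F K (checkVector m ω (2 * t) 1 (ω ^ t) ⬝ᵥ x) := by
  simp only [spectralValue, dotProduct, map_sum, zmodChar_pow hα hαω]
  refine Finset.sum_congr rfl fun j _ => ?_
  rcases Nat.mod_two_eq_zero_or_one j.val with h | h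
  · simp [checkVector, h, mul_comm]
  · rw [h, mul_one, pow_mul, hαω]
    simp only [checkVector, h, one_ne_zero, if_false, map_mul, map_pow]
    ring

theorem spectralValue_eq_add {ω : F} (hα : α ^ m = 1) (hαω : α ^ 2 = algebraMap F K ω) (i : ℕ)
    (x : ZMod m → F) : spectralValue hα i x =
      algebraMap F K (checkVector m ω i 1 0 ⬝ᵥ x) +
        α ^ i * algebraMap F K (checkVector m ω i 0 1 ⬝ᵥ x) := by
  simp only [spectralValue, dotProduct, map_sum, zmodChar_pow hα hαω, Finset.mul_sum,
    ← Finset.sum_add_distrib]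
  refine Finset.sum_congr rfl fun j _ => ?_
  rcases Nat.mod_two_eq_zero_or_one j.val with h | h
  · simp [checkVector, h, mul_comm]
  · simp only [checkVector, h, one_ne_zero, if_false, map_mul, map_pow, mul_one, one_mul, zero_mul,
      map_zero, zero_add]
    ring

theorem spectralValue_eq_zero_of_checks {ω : F} {s Q : ℕ} (hs : s ≤ 1) (hα : α ^ m = 1)
    (hαω : α ^ 2 = algebraMap F K ω) {x : ZMod m → F} (hx : ∀ κ, checks m ω s Q κ ⬝ᵥ x = 0)
    {i : ℕ} (hi : s ≤ i) (hi' : i < s + 2 * Q) : spectralValue hα i x = 0 := by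
  obtain ⟨t, rfl | rfl⟩ := Nat.even_or_odd' i
  · obtain ⟨r, rfl⟩ : ∃ r, t = r + s := ⟨t - s, by omega⟩
    have h := hx (⟨r, by omega⟩, 0)
    simp only [checks, Matrix.cons_val_zero] at h
    rw [spectralValue_even hα hαω, h, map_zero]
  · have h1 := hx (⟨t, by omega⟩, 1)
    have h2 := hx (⟨t, by omega⟩, 2)
    simp only [checks, Matrix.cons_val] at h1 h2
    rw [spectralValue_eq_add hα hαω, h1, h2]
    simp

/-- The cyclic code of the words over `F` with the zeros `α ^ i`, `2 ≤ i ≤ 2 Q`. -/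
def codeD (F : Type*) [Field F] [Algebra F K] (hα : α ^ m = 1) (Q : ℕ) :
    Submodule F (ZMod m → F) where
  carrier := {x | ∀ i, 2 ≤ i → i ≤ 2 * Q → spectralValue hα i x = 0}
  add_mem' := fun hx hy i h h' => by
    rw [spectralValue_add, hx i h h', hy i h h', add_zero]
  zero_mem' := fun i _ _ => by simp [spectralValue]
  smul_mem' := fun c x hx i h h' => by
    have := hx i h h'
    simp only [spectralValue] at this
    simp [spectralValue, mul_assoc, ← Finset.mul_sum, this]

theorem sum_even_val {M : ℕ} (hm : m = 2 * M) :
    ∑ j : ZMod m, (if j.val % 2 = 0 then (1 : K) else 0) = M := by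
  have h1 : ∑ j : ZMod m, (if j.val % 2 = 0 then (1 : K) else 0) =
      ∑ r ∈ Finset.range m, if r % 2 = 0 then (1 : K) else 0 := by
    refine Finset.sum_nbij ZMod.val (fun j _ => Finset.mem_range.2 (ZMod.val_lt j))
      (ZMod.val_injective m).injOn (fun r hr => ?_) fun _ _ => rfl
    exact ⟨(r : ZMod m), Finset.mem_coe.2 (Finset.mem_univ _),
      ZMod.val_natCast_of_lt (Finset.mem_range.1 hr)⟩
  rw [h1, hm]
  clear h1 hm
  induction M with
  | zero => simp
  | succ M ih =>
    rw [show 2 * (M + 1) = 2 * M + 1 + 1 by ring, Finset.sum_range_succ, Finset.sum_range_succ, ih]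
    have h : (2 * M + 1) % 2 = 1 := by omega
    simp [h]

/-- The vector that separates the cyclic shifts: it lies in `codeD`, but, other than the words of
`codeA`, does not vanish at `α`. -/
theorem checkVector_mem_codeD {Q : ℕ} [NeZero Q] (hm : m = 8 * Q) {ω : F}
    (hω : IsPrimitiveRoot ω (4 * Q)) (hα : α ^ m = 1) (hαω : α ^ 2 = algebraMap F K ω) :
    checkVector m ω (4 * Q - 1) 1 0 ∈ codeD F hα Q := by
  have hQ := NeZero.pos Q
  intro i hi hi'
  refine sum_eq_zero_of_add_right (c := algebraMap F K (ω ^ (4 * Q - 1 + i))) 2 (fun j => ?_) ?_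
  · have h2 : AddChar.zmodChar m hα 2 = algebraMap F K ω := by
      rw [← hαω]
      exact AddChar.zmodChar_apply' hα 2
    rw [checkVector_add_two (M := 4 * Q) (by omega) (by omega) hω.pow_eq_one,
      AddChar.map_add_eq_mul, h2, pow_add]
    simp only [map_mul, map_pow]
    ring
  · rw [show 4 * Q - 1 + i = 4 * Q + (i - 1) by omega, pow_add, hω.pow_eq_one, one_mul]
    intro h
    exact hω.pow_ne_one_of_pos_of_lt (l := i - 1) (by omega) (by omega)
      ((algebraMap F K).injective (by rw [h, map_one]))

theorem spectralValue_checkVector_ne_zero {Q : ℕ} [NeZero Q] (hm : m = 8 * Q) {ω : F}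
    (hω : IsPrimitiveRoot ω (4 * Q)) (hα : IsPrimitiveRoot α m)
    (hαω : α ^ 2 = algebraMap F K ω) :
    spectralValue hα.pow_eq_one 1 (checkVector m ω (4 * Q - 1) 1 0) ≠ 0 := by
  have hQ := NeZero.pos Q
  have h : spectralValue hα.pow_eq_one 1 (checkVector m ω (4 * Q - 1) 1 0) =
      ((4 * Q : ℕ) : K) := by
    rw [← sum_even_val (m := m) (by omega)]
    refine Finset.sum_congr rfl fun j _ => ?_
    rw [zmodChar_pow hα.pow_eq_one hαω]
    by_cases hj : j.val % 2 = 0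
    · have : (4 * Q - 1) * (j.val / 2) + j.val / 2 = 4 * Q * (j.val / 2) := by
        rw [← Nat.succ_mul, Nat.succ_eq_add_one, Nat.sub_add_cancel (by omega)]
      simp only [checkVector, hj, if_true, mul_zero, pow_zero, one_mul]
      rw [← map_mul, ← pow_add, this, pow_mul, hω.pow_eq_one, one_pow, map_one]
    · simp [checkVector, hj]
  rw [h]
  intro h0
  have : NeZero ((m : ℕ) : K) := hα.neZero'
  refine this.out ?_
  rw [show m = 2 * (4 * Q) by omega, Nat.cast_mul, h0, mul_zero]

end Spectrum

/-! ### The synchronizable code from a root of unity -/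

/-- The codes of the preceding sections form a synchronizable code. The bound `2 Q` on the number of
logical qudits is the lower bound `5 Q - 3 Q` for the codimension of `codeB` in `codeA`. -/
theorem exists_isQSC_of_primitiveRoot {F K : Type*} [Field F] [Fintype F] [DecidableEq F] [Field K]
    [Algebra F K] {m Q k cl cr : ℕ} [NeZero m] [NeZero Q] (hm : m = 8 * Q) {ω : F}
    (hω : IsPrimitiveRoot ω (4 * Q)) {α : K} (hα : IsPrimitiveRoot α m)
    (hαω : α ^ 2 = algebraMap F K ω) (hk : k ≤ 2 * Q) (hlr : cl + cr < m) :
    ∃ V : Matrix (Fin (m + cl + cr) → F) (Fin k → F) ℂ, IsQSC cl cr ((2 * Q - 1) / 2) Q V := by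
  have hQ := NeZero.pos Q
  have hBA := codeB_le_codeA (m := m) hm hω
  obtain ⟨L, hLA, hLB⟩ := exists_linearMap_of_finrank_le hBA (k := k) (by
    have h1 := finrank_codeB_le m ω Q
    have h2 := le_finrank_codeA hm ω
    omega)
  have hA : ∀ x ∈ codeA m ω Q, ∀ i, 1 ≤ i → i < 1 + 2 * Q →
      spectralValue hα.pow_eq_one i x = 0 := fun x hx i hi hi' =>
    spectralValue_eq_zero_of_checks le_rfl hα.pow_eq_one hαω (mem_codeA.1 hx) hi hi'
  refine exists_isQSC_of_codes hlr (codeA m ω Q) (codeB m ω Q) (codeD F hα.pow_eq_one Q)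
    (checkVector m ω (4 * Q - 1) 1 0) L hBA (fun x hx i hi hi' => hA x hx i (by omega) (by omega))
    (checkVector_mem_codeD hm hω hα.pow_eq_one hαω) hLA hLB ?_ ?_ ?_ ?_
  · -- the `2 Q - 1` consecutive zeros of `codeD`
    intro x hx hw
    exact eq_zero_of_spectralValue_eq_zero hα x 2 (2 * Q - 1)
      (fun i hi hi' => hx i hi (by omega)) (by omega)
  · intro x hx a i hi hi'
    rw [spectralValue_shift, hx i hi hi', mul_zero]
  · -- a cyclic shift by `a` multiplies the common value of the words of `A + g` at `α` by `α ^ (-a)`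
    intro x hx x' hx' a b h
    have h1 : spectralValue hα.pow_eq_one 1
        (fun j => (x + checkVector m ω (4 * Q - 1) 1 0) (j + a)) = spectralValue hα.pow_eq_one 1
        (fun j => (x' + checkVector m ω (4 * Q - 1) 1 0) (j + b)) := congrArg _ (funext h)
    rw [spectralValue_shift, spectralValue_shift, spectralValue_add, spectralValue_add,
      hA x hx 1 le_rfl (by omega), hA x' hx' 1 le_rfl (by omega), pow_one, pow_one] at h1
    have h2 := mul_right_cancel₀ (by
      rw [zero_add]; exact spectralValue_checkVector_ne_zero hm hω hα hαω) h1
    exact neg_injective (zmodChar_injective hα h2)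
  · -- the `2 Q` consecutive zeros of the dual of `codeB`
    intro p hp hw
    refine eq_zero_of_spectralValue_eq_zero hα p 0 (2 * Q) (fun i hi hi' => ?_) hw
    refine spectralValue_eq_zero_of_checks zero_le_one hα.pow_eq_one hαω (fun κ => ?_) hi hi'
    rw [dotProduct_comm]
    exact hp _ (Submodule.subset_span ⟨κ, rfl⟩)

theorem exists_isPrimitiveRoot_of_card {F : Type*} [Field F] [Fintype F] {N c : ℕ}
    (h : Fintype.card F = 1 + N * c) : ∃ ω : F, IsPrimitiveRoot ω N := by
  classical
  obtain ⟨ζ, hζ⟩ := IsCyclic.exists_ofOrder_eq_natCard (α := Fˣ)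
  have h1 : Nat.card Fˣ = c * N := by
    rw [Nat.card_eq_fintype_card, Fintype.card_units, h, mul_comm]
    omega
  have h2 : IsPrimitiveRoot (ζ : F) (c * N) := by
    rw [IsPrimitiveRoot.coe_units_iff, ← h1, ← hζ]
    exact IsPrimitiveRoot.orderOf ζ
  refine ⟨_, h2.pow ?_ rfl⟩
  rw [← h1]
  exact Nat.card_pos

end QSync

theorem theorem1 (n z c q : ℕ) (hn : 3 ≤ n) (hz : z = n - 1) (hc : Odd c) (hq : q = 1 + 2 ^ z * c)
    (F : Type*) [Field F] [Fintype F] [DecidableEq F] (hF : Fintype.card F = q)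
    (δ₁ : ℕ) (hδ : δ₁ ≤ 2 ^ (n - 2) - 2) (hk : 2 * δ₁ ≤ 2 ^ (n - 2))
    (cl cr : ℕ) (hlr : cl + cr < 2 ^ n) :
    ∃ V : Matrix (Fin (2 ^ n + cl + cr) → F) (Fin (2 ^ (n - 2) - 2 * δ₁) → F) ℂ,
      QSync.IsQSC cl cr ((2 ^ (n - 2) - 1) / 2) (2 ^ (n - 3)) V := by
  obtain ⟨r, rfl⟩ : ∃ r, n = r + 3 := ⟨n - 3, by omega⟩
  have h2 : 2 ^ (r + 3 - 2) = 2 * 2 ^ r := by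
    rw [show r + 3 - 2 = r + 1 by omega, pow_succ, mul_comm]
  have h4 : 2 ^ (r + 2) = 4 * 2 ^ r := by ring
  have h8 : 2 ^ (r + 3) = 8 * 2 ^ r := by ring
  have hz' : z = r + 2 := by omega
  subst hz' hq
  obtain ⟨ω, hω⟩ := QSync.exists_isPrimitiveRoot_of_card hF
  obtain ⟨α, hα⟩ := IsAlgClosed.exists_pow_nat_eq (algebraMap F (AlgebraicClosure F) ω) two_pos
  -- `α` is a square root of a root of unity of order `2 ^ (n - 1)`, so its order is `2 ^ n`
  have hαp : IsPrimitiveRoot α (2 ^ (r + 3)) := by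
    have : orderOf α = 2 ^ (r + 2 + 1) := by
      refine orderOf_eq_prime_pow (fun h => ?_) ?_
      · rw [pow_succ', pow_mul, hα, ← map_pow, ← map_one (algebraMap F (AlgebraicClosure F))] at h
        exact hω.pow_ne_one_of_pos_of_lt (by positivity) (Nat.pow_lt_pow_right (by omega) (by omega))
          ((algebraMap F (AlgebraicClosure F)).injective h)
      · rw [pow_succ', pow_mul, hα, ← map_pow, hω.pow_eq_one, map_one]
    rw [← this]
    exact IsPrimitiveRoot.orderOf α
  rw [h4] at hω
  rw [h2, show r + 3 - 3 = r by omega]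
  exact QSync.exists_isQSC_of_primitiveRoot h8 hω hαp hα (Nat.sub_le _ _) hlr
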